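/- Let $Q$ be a loop, i.e. a set with a binary operation and a two-sided neutral element $1$ such that all translations $L_x(y)=xy$ and $R_x(y)=yx$ are bijections, and write $x\backslash y=L_x^{-1}(y)$, $y/x=R_x^{-1}(y)$. Let $\mathrm{Mlt}(Q)=\langle L_x,R_x : x\in Q\rangle$ and $\mathrm{Inn}(Q)=\{f\in\mathrm{Mlt}(Q) : f(1)=1\}$. Define the commutator and the associator of elements by $$[y,x]=((yx)/y)/x,\qquad [x,y,z]=(((xy)z)/(yz))/x .$$ A word $W$ is a formal product of letters $L_t$, $R_t$ and their inverses, where the $t$ are terms in the operations $\cdot,\backslash,/,1$ and in variables $x_1,x_2,\dots$; substituting elements $u_i$ of a loop for the $x_i$ gives an element $W_{\bar u}$ of its multiplication group. $W$ is an inner word if $W_{\bar u}(1)=1$ in every loop and for every assignment $\bar u$. A subloop is normal if it is the kernel of a loop homomorphism. A normal subloop $A$ corresponds to the congruence $x\equiv_A y\iff x/y\in A$, and a congruence to the class of $1$. For congruences $\alpha,\beta$ of $Q$, the commutator $[\alpha,\beta]$ is the smallest congruence $\delta$ such that, for every loop term $t(x,y_1,\dots,y_n)$, all $(a,b)\in\alpha$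 and all $(u_i,v_i)\in\beta$, $$t(a,\bar u)\mathrel{\delta}t(a,\bar v)\ \Longrightarrow\ t(b,\bar u)\mathrel{\delta}t(b,\bar v).$$ For normal subloops $A,B$ of $Q$, $[A,B]_Q$ is the normal subloop corresponding to $[\equiv_A,\equiv_B]$. For a commutative group $(M,+)$ and a loop $F$, a loop cocycle is a triple $\Gamma=(\varphi,\psi,\theta)$ of maps $\varphi,\psi:F\times F\to\mathrm{Aut}(M)$, $\theta:F\times F\to M$ with $\varphi_{y,1}=\mathrm{id}=\psi_{1,y}$ and $\theta_{1,y}=0=\theta_{y,1}$ for all $y\in F$. The abelian extension of $M$ by $F$ over $\Gamma$ is the loop on $M\times F$ with multiplication $$(a,x)(b,y)=(\varphi_{x,y}(a)+\psi_{x,y}(b)+\theta_{x,y},\,xy);$$ it is central if $\varphi_{x,y}=\psi_{x,y}=\mathrm{id}$ for all $x,y\in F$. A loop $Q$ is a central extension of its normal subloop $A$ by $Q/A$ if $A$ is a commutative group and there is an isomorphism $f$ onto $Q$ from a central extension of $A$ by $Q/A$ such that $f(a,1)=a$ and $f(a,x)$ lies in the coset $x$, for all $a\in A$ and $x\in Q/A$.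 **Theorem.** Let $A$ be a normal subloop of a loop $Q$. The following conditions are equivalent: - (C1) $A$ is central in $Q$, that is, $[A,Q]_Q=1$. - (C2) $W_{\bar u}(a)=a$ for every inner word $W$, all $u_i\in Q$ and every $a\in A$. - (C3) $f(a)=a$ for every $f\in\mathrm{Inn}(Q)$ and every $a\in A$. - (C3') $[a,x]=[a,x,y]=[x,a,y]=[x,y,a]=1$ for every $a\in A$ and all $x,y\in Q$. - (C4) $Q$ is a central extension of $A$ by $Q/A$. -/

import Mathlib

universe u v

namespace LoopTheory

/-- A loop: a set with a multiplication, a two-sided neutral element `1`, and left and right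
divisions, `ldiv x y` being the unique solution `z` of `x * z = y` and `y / x` the unique solution
`z` of `z * x = y`. Equivalently, all left and right translations are bijections. -/
class Loop (Q : Type u) extends MulOneClass Q, Div Q where
  /-- Left division, usually written as a backslash. -/
  ldiv : Q → Q → Q
  mul_ldiv : ∀ x y : Q, x * ldiv x y = y
  ldiv_mul : ∀ x y : Q, ldiv x (x * y) = y
  rdiv_mul : ∀ x y : Q, (y / x) * x = y
  mul_rdiv : ∀ x y : Q, (y * x) / x = y

section Basic

variable {Q : Type u} [Loop Q]

theorem rdiv_eq_iff {x y z : Q} : x / y = z ↔ z * y = x := by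
  constructor
  · rintro rfl
    exact Loop.rdiv_mul _ _
  · rintro rfl
    exact Loop.mul_rdiv _ _

theorem ldiv_eq_iff {x y z : Q} : Loop.ldiv x y = z ↔ x * z = y := by
  constructor
  · rintro rfl
    exact Loop.mul_ldiv _ _
  · rintro rfl
    exact Loop.ldiv_mul _ _

theorem map_rdiv {L : Type v} [Loop L] (f : Q →* L) (x y : Q) : f (x / y) = f x / f y := by
  symm
  rw [rdiv_eq_iff, ← map_mul, Loop.rdiv_mul]

theorem map_ldiv {L : Type v} [Loop L] (f : Q →* L) (x y : Q) :
    f (Loop.ldiv x y) = Loop.ldiv (f x) (f y) := by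
  symm
  rw [ldiv_eq_iff, ← map_mul, Loop.mul_ldiv]

/-- The left translation `L_x : y ↦ x * y`. -/
def leftTranslation (x : Q) : Equiv.Perm Q where
  toFun y := x * y
  invFun y := Loop.ldiv x y
  left_inv y := Loop.ldiv_mul x y
  right_inv y := Loop.mul_ldiv x y

/-- The right translation `R_x : y ↦ y * x`. -/
def rightTranslation (x : Q) : Equiv.Perm Q where
  toFun y := y * x
  invFun y := y / x
  left_inv y := Loop.mul_rdiv x y
  right_inv y := Loop.rdiv_mul x y

/-- The commutator `[y, x] = T_y(x) / x = ((y x) / y) / x`. -/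
def loopComm (y x : Q) : Q := ((y * x) / y) / x

/-- The associator `[x, y, z] = R_{z,y}(x) / x = (((x y) z) / (y z)) / x`. -/
def loopAssoc (x y z : Q) : Q := (((x * y) * z) / (y * z)) / x

end Basic

/-- The multiplication group, generated by all left and right translations. -/
def Mlt (Q : Type u) [Loop Q] : Subgroup (Equiv.Perm Q) :=
  Subgroup.closure (Set.range leftTranslation ∪ Set.range rightTranslation)

/-- The inner mapping group: the elements of the multiplication group that fix `1`. -/
def Inn (Q : Type u) [Loop Q] : Subgroup (Equiv.Perm Q) :=
  Mlt Q ⊓ MulAction.stabilizer (Equiv.Perm Q) (1 : Q)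

/-- Loop terms in variables indexed by `ν`. -/
inductive LoopTerm (ν : Type) : Type
  | var : ν → LoopTerm ν
  | one : LoopTerm ν
  | mul : LoopTerm ν → LoopTerm ν → LoopTerm ν
  | ldiv : LoopTerm ν → LoopTerm ν → LoopTerm ν
  | rdiv : LoopTerm ν → LoopTerm ν → LoopTerm ν

/-- The value of a term in a loop under an assignment of its variables. -/
def LoopTerm.eval {ν : Type} {Q : Type u} [Loop Q] (u : ν → Q) : LoopTerm ν → Q
  | .var i => u i
  | .one => 1
  | .mul s t => s.eval u * t.eval u
  | .ldiv s t => Loop.ldiv (s.eval u) (t.eval u)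
  | .rdiv s t => s.eval u / t.eval u

/-- The letters `L_t`, `R_t` and their formal inverses, for loop terms `t`. -/
inductive Letter : Type
  | L : LoopTerm ℕ → Letter
  | R : LoopTerm ℕ → Letter
  | Linv : LoopTerm ℕ → Letter
  | Rinv : LoopTerm ℕ → Letter

/-- The interpretation of a letter as a permutation of a loop. -/
def Letter.eval {Q : Type u} [Loop Q] (u : ℕ → Q) : Letter → Equiv.Perm Q
  | .L t => leftTranslation (t.eval u)
  | .R t => rightTranslation (t.eval u)
  | .Linv t => (leftTranslation (t.eval u))⁻¹
  | .Rinv t => (rightTranslation (t.eval u))⁻¹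

/-- A word: a formal product of letters. -/
abbrev Word : Type := List Letter

/-- The permutation `W_u` obtained from a word `W` by substituting `u i` for the `i`-th variable;
the leftmost letter acts last. -/
def Word.eval {Q : Type u} [Loop Q] (u : ℕ → Q) (W : Word) : Equiv.Perm Q :=
  (W.map (Letter.eval u)).prod

/-- `W` is an inner word if `W_u(1) = 1` in every loop and for every assignment `u`.
Since `W_u(1) = 1` is an identity in the language of loops, this does not depend on
the universe over which the loops range. -/
def Word.IsInner (W : Word) : Prop :=
  ∀ (L : Type u) [Loop L] (u : ℕ → L), Word.eval u W 1 = 1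

/-- A loop congruence: an equivalence relation compatible with the multiplication and
both divisions. -/
structure LoopCon (Q : Type u) [Loop Q] extends Setoid Q where
  mul' : ∀ {w x y z : Q}, r w x → r y z → r (w * y) (x * z)
  ldiv' : ∀ {w x y z : Q}, r w x → r y z → r (Loop.ldiv w y) (Loop.ldiv x z)
  rdiv' : ∀ {w x y z : Q}, r w x → r y z → r (w / y) (x / z)

namespace LoopCon

variable {Q : Type u} [Loop Q]

/-- The factor loop by a congruence. -/
def Quot (c : LoopCon Q) : Type u := Quotient c.toSetoid

/-- The class of an element in the factor loop. -/
def cls (c : LoopCon Q) (x : Q) : c.Quot := Quotient.mk c.toSetoid x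

instance (c : LoopCon Q) : Loop c.Quot where
  mul := Quotient.map₂ (· * ·) fun _ _ h _ _ h' => c.mul' h h'
  one := c.cls 1
  div := Quotient.map₂ (· / ·) fun _ _ h _ _ h' => c.rdiv' h h'
  ldiv := Quotient.map₂ Loop.ldiv fun _ _ h _ _ h' => c.ldiv' h h'
  one_mul := by
    rintro ⟨x⟩
    exact congrArg c.cls (one_mul x)
  mul_one := by
    rintro ⟨x⟩
    exact congrArg c.cls (mul_one x)
  mul_ldiv := by
    rintro ⟨x⟩ ⟨y⟩
    exact congrArg c.cls (Loop.mul_ldiv x y)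
  ldiv_mul := by
    rintro ⟨x⟩ ⟨y⟩
    exact congrArg c.cls (Loop.ldiv_mul x y)
  rdiv_mul := by
    rintro ⟨x⟩ ⟨y⟩
    exact congrArg c.cls (Loop.rdiv_mul x y)
  mul_rdiv := by
    rintro ⟨x⟩ ⟨y⟩
    exact congrArg c.cls (Loop.mul_rdiv x y)

/-- The canonical homomorphism onto the factor loop. -/
def proj (c : LoopCon Q) : Q →* c.Quot where
  toFun := c.cls
  map_one' := rfl
  map_mul' _ _ := rfl

theorem proj_eq_one_iff (c : LoopCon Q) (x : Q) : c.proj x = 1 ↔ c.r x 1 :=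
  ⟨fun h => Quotient.exact (s := c.toSetoid) h, fun h => Quotient.sound (s := c.toSetoid) h⟩

/-- The term condition `C(α, β; δ)`: `α` centralizes `β` over `δ`. For every loop term
`t(x, y₁, y₂, …)`, all `a α b` and all `uᵢ β vᵢ`, if `t(a, u) δ t(a, v)` then
`t(b, u) δ t(b, v)`. The variable `x` is `none` and `yᵢ` is `some i`. -/
def Centralizes (α β δ : LoopCon Q) : Prop :=
  ∀ (t : LoopTerm (Option ℕ)) (a b : Q) (u v : ℕ → Q), α.r a b → (∀ i, β.r (u i) (v i)) →
    δ.r (t.eval fun o => o.elim a u) (t.eval fun o => o.elim a v) →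
    δ.r (t.eval fun o => o.elim b u) (t.eval fun o => o.elim b v)

/-- The Freese-McKenzie commutator `[α, β]` of two congruences: the smallest congruence `δ`
such that `α` centralizes `β` over `δ`, which is the intersection of all such `δ`. -/
def commutator (α β : LoopCon Q) : LoopCon Q where
  r x y := ∀ δ : LoopCon Q, Centralizes α β δ → δ.r x y
  iseqv :=
    { refl := fun x δ _ => δ.iseqv.refl x
      symm := fun h δ hδ => δ.iseqv.symm (h δ hδ)
      trans := fun h h' δ hδ => δ.iseqv.trans (h δ hδ) (h' δ hδ) }
  mul' h h' δ hδ := δ.mul' (h δ hδ) (h' δ hδ)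
  ldiv' h h' δ hδ := δ.ldiv' (h δ hδ) (h' δ hδ)
  rdiv' h h' δ hδ := δ.rdiv' (h δ hδ) (h' δ hδ)

/-- The commutator itself satisfies the term condition. -/
theorem centralizes_commutator (α β : LoopCon Q) : Centralizes α β (commutator α β) :=
  fun t a b u v hab huv h δ hδ => hδ t a b u v hab huv (h δ hδ)

end LoopCon

/-- A subloop: a subset containing `1` and closed under multiplication and both divisions. -/
structure Subloop (Q : Type u) [Loop Q] where
  carrier : Set Q
  one_mem' : (1 : Q) ∈ carrier
  mul_mem' : ∀ {x y : Q}, x ∈ carrier → y ∈ carrier → x * y ∈ carrier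
  ldiv_mem' : ∀ {x y : Q}, x ∈ carrier → y ∈ carrier → Loop.ldiv x y ∈ carrier
  rdiv_mem' : ∀ {x y : Q}, x ∈ carrier → y ∈ carrier → x / y ∈ carrier

namespace Subloop

variable {Q : Type u} [Loop Q]

instance : SetLike (Subloop Q) Q where
  coe := Subloop.carrier
  coe_injective A B h := by
    cases A
    cases B
    congr

/-- A subloop is a loop under the inherited operations. -/
instance (A : Subloop Q) : Loop A where
  mul x y := ⟨x.1 * y.1, A.mul_mem' x.2 y.2⟩
  one := ⟨1, A.one_mem'⟩
  div x y := ⟨x.1 / y.1, A.rdiv_mem' x.2 y.2⟩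
  ldiv x y := ⟨Loop.ldiv x.1 y.1, A.ldiv_mem' x.2 y.2⟩
  one_mul x := Subtype.ext (one_mul x.1)
  mul_one x := Subtype.ext (mul_one x.1)
  mul_ldiv x y := Subtype.ext (Loop.mul_ldiv x.1 y.1)
  ldiv_mul x y := Subtype.ext (Loop.ldiv_mul x.1 y.1)
  rdiv_mul x y := Subtype.ext (Loop.rdiv_mul x.1 y.1)
  mul_rdiv x y := Subtype.ext (Loop.mul_rdiv x.1 y.1)

/-- The whole loop. -/
instance : Top (Subloop Q) where
  top :=
    { carrier := Set.univ
      one_mem' := trivial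
      mul_mem' := fun _ _ => trivial
      ldiv_mem' := fun _ _ => trivial
      rdiv_mem' := fun _ _ => trivial }

/-- The trivial subloop `1`. -/
instance : Bot (Subloop Q) where
  bot :=
    { carrier := {1}
      one_mem' := rfl
      mul_mem' := by
        rintro _ _ rfl rfl
        exact mul_one 1
      ldiv_mem' := by
        rintro _ _ rfl rfl
        exact ldiv_eq_iff.2 (mul_one 1)
      rdiv_mem' := by
        rintro _ _ rfl rfl
        exact rdiv_eq_iff.2 (mul_one 1) }

/-- A subloop is normal if it is the kernel of a homomorphism of loops. (A multiplicative map
between loops automatically preserves `1` and the divisions; and the image of a homomorphism is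
a quotient of `Q`, so that it is enough to take targets in the universe of `Q`.) -/
class Normal (A : Subloop Q) : Prop where
  isKernel : ∃ (L : Type u) (_ : Loop L) (f : Q →* L), ∀ x, x ∈ A ↔ f x = 1

instance : (⊤ : Subloop Q).Normal where
  isKernel :=
    let c : LoopCon Q :=
      { r := fun _ _ => True
        iseqv := ⟨fun _ => trivial, fun _ => trivial, fun _ _ => trivial⟩
        mul' := fun _ _ => trivial
        ldiv' := fun _ _ => trivial
        rdiv' := fun _ _ => trivial }
    ⟨c.Quot, inferInstance, c.proj, fun _ =>
      ⟨fun _ => Quotient.sound (s := c.toSetoid) trivial, fun _ => trivial⟩⟩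

/-- The congruence of a normal subloop: `x` and `y` are congruent if `x / y ∈ A`, that is, if
`A x = A y`. -/
def con (A : Subloop Q) [hA : A.Normal] : LoopCon Q :=
  have key : ∃ (L : Type u) (_ : Loop L) (f : Q →* L), ∀ x y, x / y ∈ A ↔ f x = f y := by
    obtain ⟨L, hL, f, hf⟩ := hA.isKernel
    refine ⟨L, hL, f, fun x y => ?_⟩
    rw [hf, map_rdiv, rdiv_eq_iff, one_mul, eq_comm]
  { r := fun x y => x / y ∈ A
    iseqv := by
      obtain ⟨L, hL, f, hf⟩ := key
      simp only [hf]
      exact ⟨fun _ => rfl, fun h => h.symm, fun h h' => h.trans h'⟩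
    mul' := by
      obtain ⟨L, hL, f, hf⟩ := key
      simp only [hf]
      intro w x y z h h'
      rw [map_mul, map_mul, h, h']
    ldiv' := by
      obtain ⟨L, hL, f, hf⟩ := key
      simp only [hf]
      intro w x y z h h'
      rw [map_ldiv, map_ldiv, h, h']
    rdiv' := by
      obtain ⟨L, hL, f, hf⟩ := key
      simp only [hf]
      intro w x y z h h'
      rw [map_rdiv, map_rdiv, h, h'] }

/-- The factor loop `Q/A`. -/
abbrev Factor (A : Subloop Q) [A.Normal] : Type u := A.con.Quot

/-- The normal subloop of a congruence: the class of `1`. -/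
def ofCon (c : LoopCon Q) : Subloop Q where
  carrier := {x | c.r x 1}
  one_mem' := c.iseqv.refl 1
  mul_mem' h h' := by
    have := c.mul' h h'
    rwa [mul_one] at this
  ldiv_mem' h h' := by
    have := c.ldiv' h h'
    rwa [ldiv_eq_iff.2 (mul_one 1)] at this
  rdiv_mem' h h' := by
    have := c.rdiv' h h'
    rwa [rdiv_eq_iff.2 (mul_one 1)] at this

instance (c : LoopCon Q) : (ofCon c).Normal where
  isKernel := ⟨c.Quot, inferInstance, c.proj, fun x => (c.proj_eq_one_iff x).symm⟩

/-- The commutator `[A, B]_Q` of two normal subloops: the normal subloop corresponding to the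
commutator of the corresponding congruences. -/
def commutator (A B : Subloop Q) [A.Normal] [B.Normal] : Subloop Q :=
  ofCon (LoopCon.commutator A.con B.con)

/-- `A` is central in `Q` if `[A, Q]_Q = 1`. -/
def IsCentral (A : Subloop Q) [A.Normal] : Prop := commutator A ⊤ = ⊥

end Subloop

/-- A loop cocycle `(φ, ψ, θ)` for a commutative group `M` and a loop `F`. -/
structure LoopCocycle (M : Type u) [AddCommGroup M] (F : Type v) [Loop F] where
  φ : F → F → (M ≃+ M)
  ψ : F → F → (M ≃+ M)
  θ : F → F → M
  φ_one : ∀ y, φ y 1 = AddEquiv.refl M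
  ψ_one : ∀ y, ψ 1 y = AddEquiv.refl M
  θ_one_left : ∀ y, θ 1 y = 0
  θ_one_right : ∀ y, θ y 1 = 0

/-- The underlying set `M × F` of the abelian extension of `M` by `F` over a loop cocycle. -/
@[ext] structure AbExt {M : Type u} [AddCommGroup M] {F : Type v} [Loop F]
    (Γ : LoopCocycle M F) where
  fst : M
  snd : F

/-- The abelian extension over a loop cocycle is a loop with neutral element `(0, 1)` and
multiplication `(a, x)(b, y) = (φ_{x,y}(a) + ψ_{x,y}(b) + θ_{x,y}, xy)`. -/
instance {M : Type u} [AddCommGroup M] {F : Type v} [Loop F] (Γ : LoopCocycle M F) :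
    Loop (AbExt Γ) where
  mul p q := ⟨Γ.φ p.snd q.snd p.fst + Γ.ψ p.snd q.snd q.fst + Γ.θ p.snd q.snd, p.snd * q.snd⟩
  one := ⟨0, 1⟩
  ldiv p q :=
    let z := Loop.ldiv p.snd q.snd
    ⟨(Γ.ψ p.snd z).symm (q.fst - Γ.φ p.snd z p.fst - Γ.θ p.snd z), z⟩
  div p q :=
    let z := p.snd / q.snd
    ⟨(Γ.φ z q.snd).symm (p.fst - Γ.ψ z q.snd q.fst - Γ.θ z q.snd), z⟩
  one_mul p := AbExt.ext
    (show Γ.φ 1 p.snd 0 + Γ.ψ 1 p.snd p.fst + Γ.θ 1 p.snd = p.fst by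
      simp [Γ.ψ_one, Γ.θ_one_left]) (one_mul p.snd)
  mul_one p := AbExt.ext
    (show Γ.φ p.snd 1 p.fst + Γ.ψ p.snd 1 0 + Γ.θ p.snd 1 = p.fst by
      simp [Γ.φ_one, Γ.θ_one_right]) (mul_one p.snd)
  mul_ldiv p q := AbExt.ext
    (show Γ.φ p.snd (Loop.ldiv p.snd q.snd) p.fst + Γ.ψ p.snd (Loop.ldiv p.snd q.snd)
        ((Γ.ψ p.snd (Loop.ldiv p.snd q.snd)).symm (q.fst
          - Γ.φ p.snd (Loop.ldiv p.snd q.snd) p.fst - Γ.θ p.snd (Loop.ldiv p.snd q.snd)))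
        + Γ.θ p.snd (Loop.ldiv p.snd q.snd) = q.fst by
      rw [AddEquiv.apply_symm_apply]
      abel) (Loop.mul_ldiv p.snd q.snd)
  ldiv_mul p q := AbExt.ext
    (show (Γ.ψ p.snd (Loop.ldiv p.snd (p.snd * q.snd))).symm
        (Γ.φ p.snd q.snd p.fst + Γ.ψ p.snd q.snd q.fst + Γ.θ p.snd q.snd
          - Γ.φ p.snd (Loop.ldiv p.snd (p.snd * q.snd)) p.fst
          - Γ.θ p.snd (Loop.ldiv p.snd (p.snd * q.snd))) = q.fst by
      rw [Loop.ldiv_mul, AddEquiv.symm_apply_eq]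
      abel) (Loop.ldiv_mul p.snd q.snd)
  rdiv_mul p q := AbExt.ext
    (show Γ.φ (q.snd / p.snd) p.snd ((Γ.φ (q.snd / p.snd) p.snd).symm
          (q.fst - Γ.ψ (q.snd / p.snd) p.snd p.fst - Γ.θ (q.snd / p.snd) p.snd))
        + Γ.ψ (q.snd / p.snd) p.snd p.fst + Γ.θ (q.snd / p.snd) p.snd = q.fst by
      rw [AddEquiv.apply_symm_apply]
      abel) (Loop.rdiv_mul p.snd q.snd)
  mul_rdiv p q := AbExt.ext
    (show (Γ.φ (q.snd * p.snd / p.snd) p.snd).symm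
        (Γ.φ q.snd p.snd q.fst + Γ.ψ q.snd p.snd p.fst + Γ.θ q.snd p.snd
          - Γ.ψ (q.snd * p.snd / p.snd) p.snd p.fst - Γ.θ (q.snd * p.snd / p.snd) p.snd)
          = q.fst by
      rw [Loop.mul_rdiv, AddEquiv.symm_apply_eq]
      abel) (Loop.mul_rdiv p.snd q.snd)

/-- A loop cocycle is central if `φ = ψ = 1`. -/
def LoopCocycle.IsCentral {M : Type u} [AddCommGroup M] {F : Type v} [Loop F]
    (Γ : LoopCocycle M F) : Prop :=
  ∀ x y, Γ.φ x y = AddEquiv.refl M ∧ Γ.ψ x y = AddEquiv.refl M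

/-- `Q` is a central extension of its normal subloop `A` by `Q/A`: the loop `A` is a commutative
group (written additively as `M`, via the isomorphism `ι`), and there is a loop cocycle with
`φ = ψ = 1` whose extension is isomorphic to `Q`, by an isomorphism that restricts to the
identification of `M` with `A` on the elements `(m, 1)`, and that induces the identity
on `Q/A`. -/
def Subloop.IsCentralExtension {Q : Type u} [Loop Q] (A : Subloop Q) [A.Normal] : Prop :=
  ∃ (M : Type u) (_ : AddCommGroup M) (ι : Multiplicative M ≃* A) (Γ : LoopCocycle M A.Factor)
    (f : AbExt Γ ≃* Q), Γ.IsCentral ∧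
      (∀ m : M, f ⟨m, 1⟩ = ι (Multiplicative.ofAdd m)) ∧
      ∀ (m : M) (x : A.Factor), A.con.proj (f ⟨m, x⟩) = x

end LoopTheory

open LoopTheory

namespace LoopTheory

/-! ### Central elements and the multiplication group. -/

section Basic

variable {Q : Type u} [Loop Q]

/-! Every condition is compared with one elementwise statement: each `a ∈ A` satisfies `IsMulCentral
a`, which is (C3') with the divisions cleared.

For the term condition, central factors can be pulled out of any term. Replacing the distinguished
argument by its product with `c ∈ A` multiplies the value by some `m ∈ A` that does not depend on
the other arguments (`LoopTerm.exists_eval_mul_eq`). Conversely, commutator and associator terms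
equal 1 as soon as one argument is 1, so the term condition forces them to vanish on `A`.

For inner mappings, the left translation by a central element commutes with all of `Mlt Q`, hence `f
a = a * f 1 = a`. In the other direction three short inner words already express centrality.

For extensions, a transversal of `A` supplies the cocycle, and conversely the elements `(m, 1)` of a
central extension are visibly central. -/

theorem mul_right_cancel_loop {x y z : Q} (h : x * z = y * z) : x = y :=
  (rightTranslation z).injective h

@[simp] theorem rdiv_self (x : Q) : x / x = 1 := rdiv_eq_iff.2 (one_mul x)

@[simp] theorem rdiv_one (x : Q) : x / 1 = x := rdiv_eq_iff.2 (mul_one x)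

theorem rdiv_eq_one_iff {x y : Q} : x / y = 1 ↔ x = y := by
  rw [rdiv_eq_iff, one_mul, eq_comm]

theorem loopComm_eq_one_iff {x y : Q} : loopComm x y = 1 ↔ x * y = y * x := by
  rw [loopComm, rdiv_eq_one_iff, rdiv_eq_iff, eq_comm]

theorem loopAssoc_eq_one_iff {x y z : Q} :
    loopAssoc x y z = 1 ↔ x * y * z = x * (y * z) := by
  rw [loopAssoc, rdiv_eq_one_iff, rdiv_eq_iff, eq_comm]

theorem isMulCentral_iff_loopComm_loopAssoc {a : Q} :
    IsMulCentral a ↔ ∀ x y : Q, loopComm a x = 1 ∧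
      loopAssoc a x y = 1 ∧ loopAssoc x a y = 1 ∧ loopAssoc x y a = 1 := by
  simp only [loopComm_eq_one_iff, loopAssoc_eq_one_iff]
  constructor
  · intro h x y
    exact ⟨h.comm x, (h.left_assoc x y).symm, h.mid_assoc x y, h.right_assoc x y⟩
  · intro h
    exact ⟨fun x => (h x 1).1, fun x y => (h x y).2.1.symm, fun x y => (h x y).2.2.2⟩

theorem _root_.IsMulCentral.mul_mul_mul_comm_loop {a b : Q} (ha : IsMulCentral a)
    (hb : IsMulCentral b) (x y : Q) : (a * x) * (b * y) = (a * b) * (x * y) := by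
  rw [← ha.left_assoc, ← ha.left_assoc, ← hb.mid_assoc x y, ← (hb.comm x).eq, hb.left_assoc]

/-- It suffices to check commutation on the generators of `Mlt Q`, since centralizers are subgroups.
At `x = 1` this shows that inner mappings fix `a`. -/
theorem leftTranslation_comm_of_mem_Mlt {a : Q} (ha : IsMulCentral a) {f : Equiv.Perm Q}
    (hf : f ∈ Mlt Q) (x : Q) : f (a * x) = a * f x := by
  have hle : Mlt Q ≤ Subgroup.centralizer {leftTranslation a} := by
    refine (Subgroup.closure_le _).2 ?_
    rintro _ (⟨y, rfl⟩ | ⟨y, rfl⟩) <;> rw [SetLike.mem_coe, Subgroup.mem_centralizer_singleton_iff]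
    · ext x
      change y * (a * x) = a * (y * x)
      rw [← ha.mid_assoc, ← (ha.comm y).eq, ha.left_assoc]
    · ext x
      exact (ha.left_assoc x y).symm
  exact DFunLike.congr_fun (Subgroup.mem_centralizer_singleton_iff.1 (hle hf)) x

theorem Word.eval_mem_Mlt (u : ℕ → Q) (W : Word) : Word.eval u W ∈ Mlt Q := by
  refine Subgroup.list_prod_mem _ fun f hf => ?_
  have hL (x : Q) : leftTranslation x ∈ Mlt Q := Subgroup.subset_closure (Or.inl ⟨x, rfl⟩)
  have hR (x : Q) : rightTranslation x ∈ Mlt Q := Subgroup.subset_closure (Or.inr ⟨x, rfl⟩)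
  obtain ⟨l, -, rfl⟩ := List.mem_map.1 hf
  cases l with
  | L t => exact hL _
  | R t => exact hR _
  | Linv t => exact inv_mem (hL _)
  | Rinv t => exact inv_mem (hR _)

end Basic

/-! ### Inner words that detect centrality. -/

namespace Word

/-- The inner word `L_x⁻¹ R_x`. -/
def conj : Word := [.Linv (.var 0), .R (.var 0)]

/-- The inner word `R_{xy}⁻¹ R_y R_x`. -/
def rightInner : Word :=
  [.Rinv (.mul (.var 0) (.var 1)), .R (.var 1), .R (.var 0)]

/-- The inner word `L_{xy}⁻¹ L_x L_y`. -/
def leftInner : Word :=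
  [.Linv (.mul (.var 0) (.var 1)), .L (.var 0), .L (.var 1)]

variable {Q : Type u} [Loop Q] (u : ℕ → Q) (a : Q)

theorem eval_conj : Word.eval u conj a = Loop.ldiv (u 0) (a * u 0) := rfl

theorem eval_rightInner : Word.eval u rightInner a = a * u 0 * u 1 / (u 0 * u 1) := rfl

theorem eval_leftInner :
    Word.eval u leftInner a = Loop.ldiv (u 0 * u 1) (u 0 * (u 1 * a)) := rfl

theorem isInner_conj : Word.IsInner.{u} conj := fun L _ u => by
  rw [eval_conj, ldiv_eq_iff, mul_one, one_mul]

theorem isInner_rightInner : Word.IsInner.{u} rightInner := fun L _ u => by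
  rw [eval_rightInner, one_mul, rdiv_self]

theorem isInner_leftInner : Word.IsInner.{u} leftInner := fun L _ u => by
  rw [eval_leftInner, mul_one, ldiv_eq_iff, mul_one]

end Word

/-- Fixing `a` under `conj`, `rightInner` and `leftInner` gives one field each; associativity with
`a` in the middle follows from these. -/
theorem isMulCentral_of_eval_inner {Q : Type u} [Loop Q] {a : Q}
    (h : ∀ W : Word, Word.IsInner.{u} W → ∀ u : ℕ → Q, Word.eval u W a = a) :
    IsMulCentral a where
  comm x := by
    have := h _ Word.isInner_conj fun _ => x
    rw [Word.eval_conj, ldiv_eq_iff] at this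
    exact this.symm
  left_assoc x y := by
    have := h _ Word.isInner_rightInner fun n => if n = 0 then x else y
    rw [Word.eval_rightInner, rdiv_eq_iff] at this
    exact this
  right_assoc x y := by
    have := h _ Word.isInner_leftInner fun n => if n = 0 then x else y
    rw [Word.eval_leftInner, ldiv_eq_iff] at this
    exact this

/-! ### Pulling central factors out of terms. -/

namespace LoopTerm

variable {ν : Type}

/-- The commutator as a loop term. -/
def comm (s t : LoopTerm ν) : LoopTerm ν := .rdiv (.rdiv (.mul s t) s) t

/-- The associator as a loop term. -/
def assoc (s t w : LoopTerm ν) : LoopTerm ν :=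
  .rdiv (.rdiv (.mul (.mul s t) w) (.mul t w)) s

variable {Q : Type u} [Loop Q]

theorem eval_comm (u : ν → Q) (s t : LoopTerm ν) :
    (comm s t).eval u = loopComm (s.eval u) (t.eval u) := rfl

theorem eval_assoc (u : ν → Q) (s t w : LoopTerm ν) :
    (assoc s t w).eval u = loopAssoc (s.eval u) (t.eval u) (w.eval u) := rfl

/-- Multiplying the distinguished variable by an element of a central subloop multiplies the value
of a term by an element of that subloop, independent of the assignment. -/
theorem exists_eval_mul_eq {A : Subloop Q} (hA : ∀ a ∈ A, IsMulCentral a) {c : Q} (hc : c ∈ A)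
    (t : LoopTerm (Option ℕ)) :
    ∃ m ∈ A, ∀ (a : Q) (u : ℕ → Q),
      t.eval (fun o => o.elim (c * a) u) = m * t.eval fun o => o.elim a u := by
  induction t with
  | var i =>
    cases i with
    | none => exact ⟨c, hc, fun _ _ => rfl⟩
    | some i => exact ⟨1, A.one_mem', fun _ _ => (one_mul _).symm⟩
  | one => exact ⟨1, A.one_mem', fun _ _ => (one_mul _).symm⟩
  | mul s t hs ht =>
    obtain ⟨m, hm, hs⟩ := hs
    obtain ⟨n, hn, ht⟩ := ht
    refine ⟨m * n, A.mul_mem' hm hn, fun a u => ?_⟩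
    simp only [eval, hs, ht]
    exact (hA m hm).mul_mul_mul_comm_loop (hA n hn) _ _
  | ldiv s t hs ht =>
    obtain ⟨m, hm, hs⟩ := hs
    obtain ⟨n, hn, ht⟩ := ht
    have hk := A.ldiv_mem' hm hn
    refine ⟨Loop.ldiv m n, hk, fun a u => ?_⟩
    simp only [eval, hs, ht]
    -- The proposed quotient is verified by multiplying back, which reduces division to the product
    -- case.
    rw [ldiv_eq_iff, (hA m hm).mul_mul_mul_comm_loop (hA _ hk), Loop.mul_ldiv, Loop.mul_ldiv]
  | rdiv s t hs ht =>
    obtain ⟨m, hm, hs⟩ := hs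
    obtain ⟨n, hn, ht⟩ := ht
    have hk := A.rdiv_mem' hm hn
    refine ⟨m / n, hk, fun a u => ?_⟩
    simp only [eval, hs, ht]
    rw [rdiv_eq_iff, (hA _ hk).mul_mul_mul_comm_loop (hA n hn), Loop.rdiv_mul, Loop.rdiv_mul]

end LoopTerm

/-- The equality congruence. -/
instance (Q : Type u) [Loop Q] : Bot (LoopCon Q) where
  bot :=
    { r := Eq
      iseqv := eq_equivalence
      mul' := by
        rintro _ _ _ _ rfl rfl
        rfl
      ldiv' := by
        rintro _ _ _ _ rfl rfl
        rfl
      rdiv' := by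
        rintro _ _ _ _ rfl rfl
        rfl }

/-! ### Centrality through the term condition. -/

namespace Subloop

variable {Q : Type u} [Loop Q] {A : Subloop Q} [A.Normal]

/-- The commutator is itself a centralizing congruence and lies below all others, so it is trivial
exactly when equality centralizes. -/
theorem isCentral_iff_centralizes :
    A.IsCentral ↔ LoopCon.Centralizes A.con (⊤ : Subloop Q).con ⊥ := by
  constructor
  · intro h t a b u v hab huv heq
    change t.eval _ = t.eval _ at heq
    have hr := LoopCon.centralizes_commutator A.con (⊤ : Subloop Q).con t a b u v hab huv
      (heq ▸ (LoopCon.commutator _ _).iseqv.refl _)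
    -- Dividing by the right-hand value moves the relation into the class of 1, the only part of the
    -- congruence that the hypothesis controls.
    have hr' := (LoopCon.commutator _ _).rdiv' hr ((LoopCon.commutator _ _).iseqv.refl
      (t.eval fun o => o.elim b v))
    rw [rdiv_self] at hr'
    have hmem : (t.eval fun o => o.elim b u) / (t.eval fun o => o.elim b v) ∈
        Subloop.commutator A ⊤ := hr'
    rw [show Subloop.commutator A ⊤ = ⊥ from h] at hmem
    exact rdiv_eq_one_iff.1 hmem
  · intro h
    refine SetLike.ext fun x => ⟨fun hx => (hx : ∀ δ, _ → δ.r x 1) ⊥ h, ?_⟩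
    rintro rfl
    exact (LoopCon.commutator _ _).iseqv.refl 1

theorem isMulCentral_of_isCentral (h : A.IsCentral) {a : Q} (ha : a ∈ A) : IsMulCentral a := by
  rw [isCentral_iff_centralizes] at h
  -- The term condition passes from `t(1, u) = t(1, 1)` to `t(a, u) = t(a, 1)`, whose right side is
  -- 1.
  have key (t : LoopTerm (Option ℕ)) (u : ℕ → Q)
      (h1 : ∀ v : ℕ → Q, (t.eval fun o => o.elim 1 v) = 1)
      (h2 : (t.eval fun o => o.elim a fun _ => 1) = 1) :
      (t.eval fun o => o.elim a u) = 1 := by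
    rw [← h2]
    refine h t 1 a u (fun _ => 1) ?_ (fun _ => trivial) ((h1 _).trans (h1 _).symm)
    refine A.con.iseqv.symm ?_
    change a / 1 ∈ A
    rwa [rdiv_one]
  refine isMulCentral_iff_loopComm_loopAssoc.2 fun x y => ⟨?_, ?_, ?_, ?_⟩
  · exact key (.comm (.var none) (.var (some 0))) (fun _ => x)
      (fun v => by simp [LoopTerm.eval_comm, LoopTerm.eval, loopComm])
      (by simp [LoopTerm.eval_comm, LoopTerm.eval, loopComm])
  · exact key (.assoc (.var none) (.var (some 0)) (.var (some 1))) (fun n => if n = 0 then x else y)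
      (fun v => by simp [LoopTerm.eval_assoc, LoopTerm.eval, loopAssoc])
      (by simp [LoopTerm.eval_assoc, LoopTerm.eval, loopAssoc])
  · exact key (.assoc (.var (some 0)) (.var none) (.var (some 1))) (fun n => if n = 0 then x else y)
      (fun v => by
        simp [LoopTerm.eval_assoc, LoopTerm.eval, loopAssoc, Loop.mul_rdiv])
      (by simp [LoopTerm.eval_assoc, LoopTerm.eval, loopAssoc])
  · exact key (.assoc (.var (some 0)) (.var (some 1)) (.var none)) (fun n => if n = 0 then x else y)
      (fun v => by
        simp [LoopTerm.eval_assoc, LoopTerm.eval, loopAssoc, Loop.mul_rdiv])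
      (by simp [LoopTerm.eval_assoc, LoopTerm.eval, loopAssoc])

theorem isCentral_of_isMulCentral (hA : ∀ a ∈ A, IsMulCentral a) : A.IsCentral := by
  rw [isCentral_iff_centralizes]
  intro t a b u v hab _ heq
  change t.eval _ = t.eval _ at heq
  change t.eval _ = t.eval _
  obtain ⟨m, -, hm⟩ := t.exists_eval_mul_eq hA (A.con.iseqv.symm hab : b / a ∈ A)
  -- With `b = (b / a) * a`, both sides acquire the same factor `m`.
  rw [← Loop.rdiv_mul a b, hm, hm, heq]

/-! ### Central extensions. -/

theorem isMulCentral_of_isCentralExtension (h : A.IsCentralExtension) {a : Q} (ha : a ∈ A) :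
    IsMulCentral a := by
  obtain ⟨M, _, ι, Γ, f, hΓ, hf, -⟩ := h
  have hmul (p q : AbExt Γ) :
      p * q = ⟨p.fst + q.fst + Γ.θ p.snd q.snd, p.snd * q.snd⟩ :=
    AbExt.ext
      (show Γ.φ p.snd q.snd p.fst + Γ.ψ p.snd q.snd q.fst + Γ.θ p.snd q.snd = _ by
        rw [(hΓ _ _).1, (hΓ _ _).2]; rfl) rfl
  obtain ⟨m, hm⟩ : ∃ m : M, f ⟨m, 1⟩ = a :=
    ⟨(ι.symm ⟨a, ha⟩).toAdd, by rw [hf, ofAdd_toAdd, MulEquiv.apply_symm_apply]⟩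
  subst hm
  refine ⟨fun x => ?_, fun x y => ?_, fun x y => ?_⟩
  · obtain ⟨p, rfl⟩ := f.surjective x
    rw [Commute, SemiconjBy, ← map_mul, ← map_mul, hmul, hmul]
    simp [Γ.θ_one_left, Γ.θ_one_right, add_comm]
  · obtain ⟨p, rfl⟩ := f.surjective x
    obtain ⟨q, rfl⟩ := f.surjective y
    simp only [← map_mul, hmul, one_mul, Γ.θ_one_left, add_zero, add_assoc]
  · obtain ⟨p, rfl⟩ := f.surjective x
    obtain ⟨q, rfl⟩ := f.surjective y
    simp only [← map_mul, hmul, mul_one, Γ.θ_one_right, add_zero]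
    congr 2
    abel

/-- A subloop consisting of central elements is a commutative group. -/
abbrev commGroupOfIsMulCentral (hA : ∀ a ∈ A, IsMulCentral a) : CommGroup A where
  mul_assoc x y z := Subtype.ext ((hA _ x.2).left_assoc _ _).symm
  one_mul := one_mul
  mul_one := mul_one
  mul_comm x y := Subtype.ext ((hA _ x.2).comm _)
  inv x := 1 / x
  inv_mul_cancel x := Loop.rdiv_mul x 1
  div_eq_mul_inv x y := rdiv_eq_iff.2 <| by
    have hassoc : x * (1 / y) * y = x * (1 / y * y) :=
      Subtype.ext ((hA _ x.2).left_assoc _ _).symm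
    rw [hassoc, Loop.rdiv_mul, mul_one]

theorem mem_iff_proj_eq_one {x : Q} : x ∈ A ↔ A.con.proj x = 1 := by
  rw [LoopCon.proj_eq_one_iff]
  change _ ↔ x / 1 ∈ A
  rw [rdiv_one]

theorem isCentralExtension_of_isMulCentral (hA : ∀ a ∈ A, IsMulCentral a) :
    A.IsCentralExtension := by
  classical
  -- A transversal normalized at 1, so that the cocycle `θ` below vanishes when an argument is 1.
  obtain ⟨s, hs, hs1⟩ : ∃ s : A.Factor → Q, (∀ x, A.con.proj (s x) = x) ∧ s 1 = 1 := by
    have hsurj : Function.Surjective A.con.proj := Quotient.mk_surjective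
    choose r hr using hsurj
    refine ⟨Function.update r 1 1, fun x => ?_, Function.update_self ..⟩
    by_cases hx : x = 1
    · rw [hx, Function.update_self, map_one]
    · rw [Function.update_of_ne hx, hr]
  let := commGroupOfIsMulCentral hA
  have hθ (x y : A.Factor) : s x * s y / s (x * y) ∈ A := by
    rw [mem_iff_proj_eq_one, map_rdiv, map_mul, hs, hs, hs, rdiv_self]
  let Γ : LoopCocycle (Additive A) A.Factor :=
    { φ := fun _ _ => AddEquiv.refl _
      ψ := fun _ _ => AddEquiv.refl _
      θ := fun x y => Additive.ofMul ⟨s x * s y / s (x * y), hθ x y⟩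
      φ_one := fun _ => rfl
      ψ_one := fun _ => rfl
      θ_one_left := fun y => by
        apply Additive.toMul.injective
        apply Subtype.ext
        change s 1 * s y / s (1 * y) = 1
        rw [hs1, one_mul, one_mul, rdiv_self]
      θ_one_right := fun y => by
        apply Additive.toMul.injective
        apply Subtype.ext
        change s y * s 1 / s (y * 1) = 1
        rw [hs1, mul_one, mul_one, rdiv_self] }
  let f : AbExt Γ → Q := fun p => (p.fst.toMul : Q) * s p.snd
  have hproj (p : AbExt Γ) : A.con.proj (f p) = p.snd := by
    rw [map_mul, mem_iff_proj_eq_one.1 p.fst.toMul.2, one_mul, hs]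
  have hbij : Function.Bijective f := by
    constructor
    · intro p q hpq
      have h2 : p.snd = q.snd := by rw [← hproj, hpq, hproj]
      refine AbExt.ext (Additive.toMul.injective (Subtype.ext ?_)) h2
      change (p.fst.toMul : Q) * s p.snd = (q.fst.toMul : Q) * s q.snd at hpq
      rw [h2] at hpq
      exact mul_right_cancel_loop hpq
    · intro q
      have hq : q / s (A.con.proj q) ∈ A := by
        rw [mem_iff_proj_eq_one, map_rdiv, hs, rdiv_self]
      exact ⟨⟨Additive.ofMul ⟨_, hq⟩, A.con.proj q⟩, Loop.rdiv_mul _ _⟩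
  have hmul (p q : AbExt Γ) : f (p * q) = f p * f q := by
    -- The factor `s x * s y / s (x * y)` measures how far `s` is from a homomorphism; being
    -- central, it reassociates and cancels.
    change (p.fst.toMul : Q) * q.fst.toMul * (s p.snd * s q.snd / s (p.snd * q.snd)) *
        s (p.snd * q.snd) = (p.fst.toMul : Q) * s p.snd * (q.fst.toMul * s q.snd)
    rw [(hA _ p.fst.toMul.2).mul_mul_mul_comm_loop (hA _ q.fst.toMul.2),
      (hA _ (hθ p.snd q.snd)).mid_assoc, Loop.rdiv_mul]
  refine ⟨Additive A, inferInstance, ⟨Equiv.refl _, fun _ _ => rfl⟩, Γ,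
    ⟨Equiv.ofBijective f hbij, hmul⟩, fun _ _ => ⟨rfl, rfl⟩, fun m => ?_, fun m x => hproj ⟨m, x⟩⟩
  change (m.toMul : Q) * s 1 = m.toMul
  rw [hs1, mul_one]

end Subloop

end LoopTheory

open LoopTheory
theorem theorem3p2 {Q : Type u} [Loop Q] (A : Subloop Q) [A.Normal] :
    List.TFAE [
      A.IsCentral,
      (∀ W : Word, Word.IsInner.{u} W → ∀ u : ℕ → Q, ∀ a ∈ A, Word.eval u W a = a),
      (∀ f ∈ Inn Q, ∀ a ∈ A, f a = a),
      (∀ a ∈ A, ∀ x y : Q, loopComm a x = 1 ∧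
        loopAssoc a x y = 1 ∧ loopAssoc x a y = 1 ∧ loopAssoc x y a = 1),
      A.IsCentralExtension] := by
  simp only [← isMulCentral_iff_loopComm_loopAssoc]
  tfae_have 1 → 4 := fun h _ ha => Subloop.isMulCentral_of_isCentral h ha
  tfae_have 4 → 1 := Subloop.isCentral_of_isMulCentral
  tfae_have 4 → 5 := Subloop.isCentralExtension_of_isMulCentral
  tfae_have 5 → 4 := fun h _ ha => Subloop.isMulCentral_of_isCentralExtension h ha
  tfae_have 4 → 3 := by
    intro h f hf a ha
    have := leftTranslation_comm_of_mem_Mlt (h a ha) hf.1 1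
    rwa [show f 1 = 1 from hf.2, mul_one] at this
  tfae_have 3 → 2 := fun h W hW u a ha => h _ ⟨Word.eval_mem_Mlt u W, hW Q u⟩ a ha
  tfae_have 2 → 4 := fun h a ha => isMulCentral_of_eval_inner fun W hW u => h W hW u a ha
  tfae_finish
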